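/- A family $\mathcal N$ of subsets of a topological space $X$ is a $k$-network in $X$ if, whenever $K\subset U$ with $K$ compact and $U$ open in $X$, there is a finite subfamily $\mathcal F\subset\mathcal N$ with $K\subset\bigcup\mathcal F\subset U$. A topological space is an $\aleph_0$-space if it is regular (Hausdorff included) and has a countable $k$-network. Theorem. Let $X$ be a countable $\aleph_0$-space, and let $E=C_c(X)$ be the space of all continuous real-valued functions on $X$ with the compact-open topology. Let $E'$ be the space of all continuous linear functionals on $E$. Then $E$ endowed with its weak topology $\sigma(E,E')$ is an $\aleph_0$-space. -/

import Mathlib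

/-- A family `N` of subsets of a topological space `X` is a `k`-network in `X` if, whenever
`K ⊆ U` with `K` compact and `U` open in `X`, there is a finite subfamily `F` of `N` with
`K ⊆ ⋃ F ⊆ U`. -/
def IsKNetwork {X : Type*} [TopologicalSpace X] (N : Set (Set X)) : Prop :=
  ∀ K U : Set X, IsCompact K → IsOpen U → K ⊆ U →
    ∃ F : Set (Set X), F ⊆ N ∧ F.Finite ∧ K ⊆ ⋃₀ F ∧ ⋃₀ F ⊆ U

/-- An `ℵ₀`-space is a regular (Hausdorff) topological space with a countable `k`-network. -/
def IsAlephZeroSpace (X : Type*) [TopologicalSpace X] : Prop :=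
  T3Space X ∧ ∃ N : Set (Set X), N.Countable ∧ IsKNetwork N

/-- A real topological vector space `E` is a weakly `ℵ₀`-space if `E` with its weak topology
`σ(E, E')` is an `ℵ₀`-space. Here `E'` is the space of continuous linear functionals on `E`, and
`WeakSpace ℝ E` is `E` with the topology `σ(E, E')`. -/
def IsWeaklyAlephZeroSpace (E : Type*) [AddCommGroup E] [Module ℝ E] [TopologicalSpace E] :
    Prop :=
  IsAlephZeroSpace (WeakSpace ℝ E)

/-!
Every continuous linear functional `φ` on `C(X, ℝ)` satisfies `|φ g| ≤ C * r` whenever `|g| ≤ r` on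
some compact set `K` (`exists_bound_of_continuousLinearMap`). Since `X` is countable, `φ` is
continuous for the topology of pointwise convergence on every set `{g | ∀ x ∈ K, |g x| ≤ M}`
(`tendsto_apply_of_pointwise`). This is the dominated convergence theorem for the measure
representing `φ`, but it is proved here without a representation theorem. A gliding hump shows that
each point `x` has a neighbourhood `U` such that `φ` is small on functions bounded by `1` that
vanish at `x` and off `U`. Making the smallness at `x` a term of a convergent series indexed by the
countable set `X`, covering `K` by finitely many such neighbourhoods and splitting along a partition
of unity, `φ` is small on all functions bounded by `1` that vanish on a suitable finite set.

A weakly compact set `W` is uniformly bounded on each compact subset of `X`, by the Banach–Steinhaus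
theorem in the dual of `C(K, ℝ)`. If `A n` is a decreasing sequence of sets containing `K` that is
eventually inside every open neighbourhood of `K`, then `W` is uniformly bounded on some `A n`:
otherwise `W` would be unbounded on a compact set of the form `K ∪ {x₀, x₁, …}` with `x n ∈ A n`.
A countable `k`-network of `X` yields such sequences inside a fixed countable family
(`IsKNetwork.exists_superset_bounded`).

Hence, for `A` in that countable family, `m : ℕ` and `b` in a countable base of the product topology
of `X → ℝ`, the sets of all `f ∈ b` with `|f| ≤ m` on `A` form a countable `k`-network for the weak
topology (`isKNetwork_weakNetwork`).
-/

open Set Filter Topology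

/-! ### Functionals on `C(X, ℝ)` and pointwise convergence -/

section Functionals

variable {X : Type*} [TopologicalSpace X]

/-- A continuous linear functional is dominated by a multiple of the supremum over a compact set.
The case `r = 0` says that its value depends only on the restriction to that set. -/
lemma exists_bound_of_continuousLinearMap (φ : C(X, ℝ) →L[ℝ] ℝ) :
    ∃ (K : Set X) (C : ℝ), IsCompact K ∧ 0 ≤ C ∧
      ∀ (g : C(X, ℝ)) (r : ℝ), 0 ≤ r → (∀ x ∈ K, |g x| ≤ r) → |φ g| ≤ C * r := by
  have hU : φ ⁻¹' Metric.ball 0 1 ∈ 𝓝 (0 : C(X, ℝ)) :=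
    φ.continuous.continuousAt.preimage_mem_nhds
      (by simpa using Metric.ball_mem_nhds (0 : ℝ) one_pos)
  obtain ⟨⟨K, ε⟩, ⟨hK, hε⟩, hKε⟩ := (nhds_basis_uniformity'
    (Metric.uniformity_basis_dist.compactConvergenceUniformity (α := X) (β := ℝ))).mem_iff.1 hU
  simp only at hK hε
  refine ⟨K, ε⁻¹, hK, by positivity, fun g r hr hg ↦ le_of_forall_pos_le_add fun η hη ↦ ?_⟩
  -- adding `η * ε` to `r` makes the scaling factor meaningful and the inequalities strict
  have hpos : 0 < r + η * ε := by positivity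
  have hs : 0 < ε / (r + η * ε) := by positivity
  have hmem : (ε / (r + η * ε)) • g ∈ φ ⁻¹' Metric.ball 0 1 := by
    refine hKε fun x hx ↦ ?_
    have : ε / (r + η * ε) * |g x| < ε := by
      rw [div_mul_eq_mul_div, div_lt_iff₀ hpos]
      have := hg x hx
      have : 0 < η * ε := by positivity
      gcongr
      linarith
    simpa [Real.dist_eq, abs_mul, abs_of_pos hs] using this
  have h1 : ε / (r + η * ε) * |φ g| < 1 := by
    rw [mem_preimage, map_smul, mem_ball_zero_iff, norm_smul, Real.norm_of_nonneg hs.le] at hmem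
    exact hmem
  rw [div_mul_eq_mul_div, div_lt_one hpos] at h1
  have : |φ g| ≤ (r + η * ε) / ε := by rw [le_div_iff₀ hε]; linarith
  calc |φ g| ≤ (r + η * ε) / ε := this
    _ = ε⁻¹ * r + η := by field_simp

/-- Soft thresholding: subtracting from `g` its clamp to `[-δ, δ]` makes it vanish where
it is small. -/
lemma exists_truncation (g : C(X, ℝ)) {δ : ℝ} (hδ : 0 ≤ δ) :
    ∃ h : C(X, ℝ), (∀ x, |g x - h x| ≤ δ) ∧ (∀ x, |h x| ≤ |g x|) ∧
      ∀ x, |g x| ≤ δ → h x = 0 := by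
  refine ⟨g - (g ⊓ .const X δ) ⊔ .const X (-δ), fun x ↦ ?_, fun x ↦ ?_, fun x hx ↦ ?_⟩
  · simp only [ContinuousMap.sub_apply, ContinuousMap.sup_apply, ContinuousMap.inf_apply,
      ContinuousMap.const_apply]
    grind
  · simp only [ContinuousMap.sub_apply, ContinuousMap.sup_apply, ContinuousMap.inf_apply,
      ContinuousMap.const_apply]
    grind
  · simp only [ContinuousMap.sub_apply, ContinuousMap.sup_apply, ContinuousMap.inf_apply,
      ContinuousMap.const_apply]
    grind

lemma exists_clamp (g : C(X, ℝ)) :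
    ∃ h : C(X, ℝ), (∀ x, |h x| ≤ 1) ∧ (∀ x, |h x| ≤ |g x|) ∧ ∀ x, |g x| ≤ 1 → h x = g x := by
  refine ⟨(g ⊓ .const X 1) ⊔ .const X (-1), fun x ↦ ?_, fun x ↦ ?_, fun x hx ↦ ?_⟩ <;>
  · simp only [ContinuousMap.sup_apply, ContinuousMap.inf_apply, ContinuousMap.const_apply]
    grind

/-- Gliding hump: in terms of the measure representing `φ`, small punctured neighbourhoods of a
point have small total variation. -/
lemma exists_nhds_apply_le (φ : C(X, ℝ) →L[ℝ] ℝ) {C : ℝ} (hC : 0 ≤ C)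
    (hφ : ∀ (g : C(X, ℝ)) (r : ℝ), 0 ≤ r → (∀ x, |g x| ≤ r) → |φ g| ≤ C * r)
    (x : X) {ε : ℝ} (hε : 0 < ε) :
    ∃ U : Set X, IsOpen U ∧ x ∈ U ∧ ∀ g : C(X, ℝ), (∀ y, |g y| ≤ 1) → g x = 0 →
      (∀ y ∉ U, g y = 0) → |φ g| ≤ ε := by
  by_contra! H
  have H' : ∀ U : Set X, IsOpen U → x ∈ U → ∃ g : C(X, ℝ), (∀ y, |g y| ≤ 1) ∧ g x = 0 ∧
      (∀ y ∉ U, g y = 0) ∧ ε < φ g := by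
    intro U hU hxU
    obtain ⟨g, h1, h2, h3, h4⟩ := H U hU hxU
    rcases lt_abs.1 h4 with h | h
    · exact ⟨g, h1, h2, h3, h⟩
    · exact ⟨-g, by simpa using h1, by simpa using h2, by simpa using h3, by simpa using h⟩
  -- otherwise disjointly supported functions on which `φ` exceeds `ε / 2` can be summed, `n` of
  -- them in any neighbourhood of `x`, contradicting the boundedness of `φ`
  have key : ∀ n : ℕ, ∀ U : Set X, IsOpen U → x ∈ U → ∃ h : C(X, ℝ), (∀ y, |h y| ≤ 1) ∧
      (∀ y ∉ U, h y = 0) ∧ n * (ε / 2) ≤ φ h := by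
    intro n
    induction n with
    | zero => exact fun U _ _ ↦ ⟨0, by simp, by simp, by simp⟩
    | succ n ih =>
      intro U hU hxU
      obtain ⟨g, h1, h2, h3, h4⟩ := H' U hU hxU
      have hδ : 0 < ε / (2 * (C + 1)) := by positivity
      obtain ⟨g', t1, t2, t3⟩ := exists_truncation g hδ.le
      -- `g'` vanishes near `x`, which leaves room for the remaining `n` functions
      obtain ⟨h, k1, k2, k3⟩ := ih (U ∩ {y | |g y| < ε / (2 * (C + 1))})
        (hU.inter (isOpen_lt (by fun_prop) (by fun_prop))) ⟨hxU, by simpa [h2] using hδ⟩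
      refine ⟨g' + h, fun y ↦ ?_, fun y hy ↦ ?_, ?_⟩
      · by_cases hy : |g y| < ε / (2 * (C + 1))
        · simpa [t3 y hy.le] using k1 y
        · simpa [k2 y (fun h ↦ hy h.2)] using (t2 y).trans (h1 y)
      · have : g' y = 0 := t3 y (by simpa [h3 y hy] using hδ.le)
        simp [this, k2 y (fun h ↦ hy h.1)]
      · have h5 := hφ (g - g') _ hδ.le (by simpa using t1)
        have h6 : C * (ε / (2 * (C + 1))) ≤ ε / 2 := by
          rw [mul_div_assoc', div_le_div_iff₀ (by positivity) (by positivity)]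
          nlinarith
        have h7 := (le_abs_self _).trans (h5.trans h6)
        rw [map_sub] at h7
        push_cast
        rw [map_add]
        linarith
  obtain ⟨n, hn⟩ := exists_nat_gt (C / (ε / 2))
  obtain ⟨h, h1, -, h3⟩ := key n univ isOpen_univ (mem_univ x)
  have := (le_abs_self _).trans (hφ h 1 zero_le_one h1)
  rw [div_lt_iff₀ (by positivity)] at hn
  linarith

/-- In terms of the measure representing `φ`: outside a finite set, the total variation is small. -/
lemma exists_finset_apply_le [Countable X] [T3Space X] (φ : C(X, ℝ) →L[ℝ] ℝ) {K : Set X}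
    (hK : IsCompact K) {C : ℝ} (hC : 0 ≤ C)
    (hφ : ∀ (g : C(X, ℝ)) (r : ℝ), 0 ≤ r → (∀ x ∈ K, |g x| ≤ r) → |φ g| ≤ C * r)
    {ε : ℝ} (hε : 0 < ε) :
    ∃ F : Finset X, ∀ g : C(X, ℝ), (∀ y, |g y| ≤ 1) → (∀ x ∈ F, g x = 0) → |φ g| ≤ ε := by
  obtain ⟨w, hw, hwsum⟩ := (to_countable (univ : Set X)).exists_pos_forall_sum_le hε
  choose U hU hxU hUφ using fun x ↦
    exists_nhds_apply_le φ hC (fun g r hr h ↦ hφ g r hr fun x _ ↦ h x) x (hw x)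
  obtain ⟨F, hF⟩ := hK.elim_finite_subcover U hU fun x _ ↦ mem_iUnion.2 ⟨x, hxU x⟩
  refine ⟨F, fun g hg hgF ↦ ?_⟩
  obtain ⟨ρ, hρ⟩ := PartitionOfUnity.exists_isSubordinate_of_locallyFinite hK.isClosed
    (fun i : F ↦ U i) (fun i ↦ hU i) (locallyFinite_of_finite _)
    (fun x hx ↦ by simpa using hF hx)
  -- the two functions agree on `K`, which is all that `φ` sees
  have hsum : φ g = ∑ i : F, φ (ρ i * g) := by
    rw [← map_sum, ← sub_eq_zero, ← map_sub, ← abs_nonpos_iff]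
    refine (hφ _ 0 le_rfl fun x hx ↦ ?_).trans (by simp)
    have h1 : ∑ i : F, ρ i x = 1 := by
      rw [← finsum_eq_sum_of_fintype]; exact ρ.sum_eq_one hx
    rw [ContinuousMap.sub_apply, ContinuousMap.sum_apply]
    simp only [ContinuousMap.mul_apply]
    rw [← Finset.sum_mul, h1, one_mul, sub_self, abs_zero]
  calc |φ g| ≤ ∑ i : F, |φ (ρ i * g)| := hsum ▸ Finset.abs_sum_le_sum_abs _ _
    _ ≤ ∑ i : F, w i := by
      refine Finset.sum_le_sum fun i _ ↦ hUφ i _ (fun y ↦ ?_) ?_ fun y hy ↦ ?_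
      · have h1 := ρ.nonneg i y
        have h2 := ρ.le_one i y
        simpa [abs_mul, abs_of_nonneg h1] using mul_le_one₀ h2 (abs_nonneg _) (hg y)
      · simp [hgF i i.2]
      · have : ρ i y = 0 := by
          by_contra h
          exact hy (hρ i (subset_tsupport _ h))
        simp [this]
    _ = ∑ x ∈ F, w x := Finset.sum_coe_sort F w
    _ ≤ ε := hwsum F (subset_univ _)

/-- On functions uniformly bounded on `K`, a functional dominated by the supremum over `K` is
continuous for the topology of pointwise convergence on `X`. -/
lemma tendsto_apply_of_pointwise [Countable X] [T3Space X] (φ : C(X, ℝ) →L[ℝ] ℝ) {K : Set X}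
    (hK : IsCompact K) {C : ℝ} (hC : 0 ≤ C)
    (hφ : ∀ (g : C(X, ℝ)) (r : ℝ), 0 ≤ r → (∀ x ∈ K, |g x| ≤ r) → |φ g| ≤ C * r)
    {M : ℝ} {f : C(X, ℝ)} (hf : ∀ x ∈ K, |f x| ≤ M) :
    Tendsto φ (comap (⇑) (𝓝 (f : X → ℝ)) ⊓ 𝓟 {g | ∀ x ∈ K, |g x| ≤ M}) (𝓝 (φ f)) := by
  rw [Metric.tendsto_nhds]
  intro ε hε
  set R : ℝ := 2 * |M| + 1
  have hRpos : 0 < R := by positivity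
  set η : ℝ := ε / R / 4 with hη'
  have hη : 0 < η := by positivity
  obtain ⟨F, hF⟩ := exists_finset_apply_le φ hK hC hφ hη
  set δ : ℝ := η / (C + 1) with hδ'
  have hδ : 0 < δ := by positivity
  have hev : ∀ᶠ g : C(X, ℝ) in comap (⇑) (𝓝 (f : X → ℝ)), ∀ x ∈ F, |g x - f x| < R * δ := by
    rw [Filter.eventually_all_finset]
    intro x _
    refine Eventually.comap (p := fun u : X → ℝ ↦ |u x - f x| < R * δ) ?_ _
    exact (isOpen_lt (f := fun u : X → ℝ ↦ |u x - f x|) (g := fun _ ↦ R * δ)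
      (by fun_prop) (by fun_prop)).mem_nhds (by simp; positivity)
  rw [eventually_inf_principal]
  filter_upwards [hev] with g hg hgM
  -- rescale the difference so that it is bounded by `1` on `K`
  set d : C(X, ℝ) := R⁻¹ • (g - f) with hd
  have hd1 : ∀ x ∈ K, |d x| ≤ 1 := fun x hx ↦ by
    have h1 := hgM x hx
    have h2 := hf x hx
    have h3 := abs_sub (g x) (f x)
    have h4 := le_abs_self M
    have : R⁻¹ * |g x - f x| ≤ 1 := by
      rw [inv_mul_le_iff₀ hRpos]; linarith
    simpa [hd, abs_mul, abs_of_pos hRpos] using this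
  have hdF : ∀ x ∈ F, |d x| ≤ δ := fun x hx ↦ by
    have : R⁻¹ * |g x - f x| ≤ δ := by
      rw [inv_mul_le_iff₀ hRpos]; exact (hg x hx).le
    simpa [hd, abs_mul, abs_of_pos hRpos] using this
  -- `d'` agrees with `d` on `K`, and `d''` is close to `d'` and vanishes on `F`
  obtain ⟨d', c1, c2, c3⟩ := exists_clamp d
  obtain ⟨d'', t1, t2, t3⟩ := exists_truncation d' hδ.le
  have e1 : |φ d''| ≤ η := hF d'' (fun y ↦ (t2 y).trans (c1 y))
    fun x hx ↦ t3 x ((c2 x).trans (hdF x hx))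
  have e2 : |φ (d - d'')| ≤ C * δ := hφ _ _ hδ.le fun x hx ↦ by
    simpa [c3 x (hd1 x hx)] using t1 x
  have e3 : C * δ ≤ η := by
    rw [hδ', mul_div_assoc', div_le_iff₀ (by positivity)]
    nlinarith
  have e4 : |φ d| ≤ 2 * η := by
    have := abs_add_le (φ (d - d'')) (φ d'')
    rw [← map_add, sub_add_cancel] at this
    linarith
  have e5 : φ g - φ f = R * φ d := by
    rw [hd, map_smul, map_sub, smul_eq_mul, mul_inv_cancel_left₀ hRpos.ne']
  rw [Real.dist_eq, e5, abs_mul, abs_of_pos hRpos]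
  calc R * |φ d| ≤ R * (2 * η) := by gcongr
    _ = ε / 2 := by rw [hη']; field_simp; norm_num
    _ < ε := by linarith

end Functionals

/-! ### Weakly compact sets are bounded on compact sets -/

section Bounded

variable {X : Type*} [TopologicalSpace X]

lemma exists_bound_on_compact_of_isCompact_weakSpace {W : Set (WeakSpace ℝ C(X, ℝ))}
    (hW : IsCompact W) {K : Set X} (hK : IsCompact K) :
    ∃ M : ℝ, ∀ f : C(X, ℝ), toWeakSpace ℝ _ f ∈ W → ∀ x ∈ K, |f x| ≤ M := by
  have : CompactSpace K := isCompact_iff_compactSpace.1 hK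
  let R : C(X, ℝ) →L[ℝ] C(K, ℝ) :=
    ContinuousMap.compCLM ℝ ℝ (⟨Subtype.val, continuous_subtype_val⟩ : C(K, X))
  obtain ⟨M, hM⟩ := banach_steinhaus
    (g := fun f : {f : C(X, ℝ) // toWeakSpace ℝ _ f ∈ W} ↦
      NormedSpace.inclusionInDoubleDual ℝ C(K, ℝ) (R f)) (by
    intro ψ
    obtain ⟨c, hc⟩ := hW.exists_bound_of_continuousOn
      (f := fun f ↦ (ψ.comp R) ((toWeakSpace ℝ _).symm f))
      (WeakBilin.eval_continuous (topDualPairing ℝ C(X, ℝ)).flip (ψ.comp R)).continuousOn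
    exact ⟨c, fun f ↦ hc _ f.2⟩)
  refine ⟨M, fun f hf x hx ↦ ?_⟩
  have h1 := hM ⟨f, hf⟩
  have h2 : ‖R f‖ ≤ M := by
    rw [← (NormedSpace.inclusionInDoubleDualLi ℝ (E := C(K, ℝ))).norm_map]
    exact h1
  exact ((R f).norm_coe_le_norm ⟨x, hx⟩).trans h2

end Bounded

/-! ### Countable outer approximation of compact sets -/

section Network

variable {X : Type*}

/-- The finite intersections of finite unions of members of `N`. -/
def networkInters (N : Set (Set X)) : Set (Set X) :=
  (fun G : Set (Set X) ↦ ⋂₀ G) '' {G | G.Finite ∧ G ⊆ (fun F : Set (Set X) ↦ ⋃₀ F) ''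
    {F | F.Finite ∧ F ⊆ N}}

lemma countable_networkInters {N : Set (Set X)} (hN : N.Countable) :
    (networkInters N).Countable :=
  (countable_ofPred_finite_subset ((countable_ofPred_finite_subset hN).image _)).image _

variable [TopologicalSpace X]

lemma IsKNetwork.exists_antitone_networkInters {N : Set (Set X)} (hN : IsKNetwork N)
    (hc : N.Countable) {K : Set X} (hK : IsCompact K) :
    ∃ A : ℕ → Set X, Antitone A ∧ (∀ n, A n ∈ networkInters N) ∧ (∀ n, K ⊆ A n) ∧
      ∀ U, IsOpen U → K ⊆ U → ∃ n, A n ⊆ U := by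
  set T : Set (Set X) := {B ∈ (fun F : Set (Set X) ↦ ⋃₀ F) '' {F | F.Finite ∧ F ⊆ N} | K ⊆ B}
    with hT
  have hTne : T.Nonempty := by
    obtain ⟨F, h1, h2, h3, -⟩ := hN K univ hK isOpen_univ (subset_univ _)
    exact ⟨⋃₀ F, ⟨F, ⟨h2, h1⟩, rfl⟩, h3⟩
  obtain ⟨B, hB⟩ :=
    (((countable_ofPred_finite_subset hc).image _).mono (sep_subset _ _)).exists_eq_range hTne
  have hBT : ∀ i, B i ∈ T := fun i ↦ by rw [hT, hB]; exact mem_range_self i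
  refine ⟨fun n ↦ ⋂₀ (B '' Iic n), fun m n h ↦ sInter_subset_sInter (by gcongr),
    fun n ↦ ⟨_, ⟨(finite_Iic n).image B, ?_⟩, rfl⟩, fun n ↦ ?_, fun U hU hKU ↦ ?_⟩
  · rintro _ ⟨i, -, rfl⟩
    exact (hBT i).1
  · rintro x hx _ ⟨i, -, rfl⟩
    exact (hBT i).2 hx
  · obtain ⟨F, h1, h2, h3, h4⟩ := hN K U hK hU hKU
    have hF : ⋃₀ F ∈ T := ⟨⟨F, ⟨h2, h1⟩, rfl⟩, h3⟩
    obtain ⟨n, hn⟩ : ⋃₀ F ∈ range B := hB.le hF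
    refine ⟨n, fun x hx ↦ h4 ?_⟩
    rw [← hn]
    exact hx _ ⟨n, self_mem_Iic, rfl⟩

/-- A compact set together with a sequence whose terms lie in an outer base at that set is
compact. -/
lemma isCompact_union_range {K : Set X} (hK : IsCompact K) {A : ℕ → Set X} (hA : Antitone A)
    (hAK : ∀ U, IsOpen U → K ⊆ U → ∃ n, A n ⊆ U) {x : ℕ → X} (hx : ∀ n, x n ∈ A n) :
    IsCompact (K ∪ range x) := by
  refine isCompact_of_finite_subcover fun {ι} U hU hcov ↦ ?_
  obtain ⟨t, ht⟩ := hK.elim_finite_subcover U hU (subset_union_left.trans hcov)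
  obtain ⟨n, hn⟩ := hAK _ (isOpen_biUnion fun i (_ : i ∈ t) ↦ hU i) ht
  obtain ⟨s, hs⟩ := ((finite_Iio n).image x).isCompact.elim_finite_subcover U hU
    ((image_subset_range _ _).trans (subset_union_right.trans hcov))
  classical
  refine ⟨t ∪ s, ?_⟩
  rw [Finset.set_biUnion_union]
  rintro y (hy | ⟨k, rfl⟩)
  · exact .inl (ht hy)
  · rcases lt_or_ge k n with hk | hk
    · exact .inr (hs ⟨k, hk, rfl⟩)
    · exact .inl (hn (hA hk (hx k)))

/-- A family of functions which is uniformly bounded on compact sets is uniformly bounded on some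
member of the countable family `networkInters N` containing a given compact set. -/
lemma IsKNetwork.exists_superset_bounded {N : Set (Set X)} (hN : IsKNetwork N)
    (hc : N.Countable) {W : Set C(X, ℝ)}
    (hW : ∀ L, IsCompact L → ∃ M : ℝ, ∀ f ∈ W, ∀ x ∈ L, |f x| ≤ M)
    {K : Set X} (hK : IsCompact K) :
    ∃ A ∈ networkInters N, K ⊆ A ∧ ∃ m : ℕ, ∀ f ∈ W, ∀ x ∈ A, |f x| ≤ m := by
  obtain ⟨A, hA, hAN, hKA, hAU⟩ := hN.exists_antitone_networkInters hc hK
  by_contra! H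
  choose f hf x hx hfx using fun n ↦ H (A n) (hAN n) (hKA n) n
  obtain ⟨M, hM⟩ := hW _ (isCompact_union_range hK hA hAU hx)
  obtain ⟨n, hn⟩ := exists_nat_ge M
  exact (hfx n).not_ge ((hM _ (hf n) _ (.inr ⟨n, rfl⟩)).trans hn)

end Network

/-! ### A `k`-network for the weak topology -/

section Weak

variable {X : Type*} [TopologicalSpace X]

lemma continuous_coe_weakSpace :
    Continuous fun (f : WeakSpace ℝ C(X, ℝ)) ↦ ((toWeakSpace ℝ C(X, ℝ)).symm f : X → ℝ) :=
  continuous_pi fun x ↦ WeakBilin.eval_continuous (topDualPairing ℝ C(X, ℝ)).flip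
    (ContinuousMap.evalCLM ℝ x)

instance t3Space_weakSpace_continuousMap : T3Space (WeakSpace ℝ C(X, ℝ)) := by
  have : T2Space (WeakSpace ℝ C(X, ℝ)) := .of_injective_continuous
    (DFunLike.coe_injective.comp (toWeakSpace ℝ C(X, ℝ)).symm.injective) continuous_coe_weakSpace
  infer_instance

/-- Near each point of a weakly compact set `W`, a weakly open set contains the trace of a pointwise
neighbourhood on a set `{g | ∀ x ∈ A, |g x| ≤ m}` which contains all of `W`. -/
lemma exists_pointwise_nhds_subset [Countable X] [T3Space X] {N : Set (Set X)}
    (hN : IsKNetwork N) (hc : N.Countable) {W U : Set (WeakSpace ℝ C(X, ℝ))}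
    (hW : IsCompact W) (hU : IsOpen U) {f : C(X, ℝ)} (hfW : toWeakSpace ℝ _ f ∈ W)
    (hfU : toWeakSpace ℝ _ f ∈ U) :
    ∃ A ∈ networkInters N, ∃ m : ℕ,
      (∀ g : C(X, ℝ), toWeakSpace ℝ _ g ∈ W → ∀ x ∈ A, |g x| ≤ m) ∧
      ∃ V ∈ 𝓝 (f : X → ℝ), ∀ g : C(X, ℝ), (∀ x ∈ A, |g x| ≤ m) → (g : X → ℝ) ∈ V →
        toWeakSpace ℝ _ g ∈ U := by
  obtain ⟨O, hO, rfl⟩ := isOpen_induced_iff.1 hU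
  obtain ⟨I, u, hu, huO⟩ := isOpen_pi_iff.1 hO _ hfU
  choose K C hK hC hφ using exists_bound_of_continuousLinearMap (X := X)
  obtain ⟨A, hAN, hKA, m, hm⟩ := hN.exists_superset_bounded hc
    (W := {g | toWeakSpace ℝ _ g ∈ W})
    (fun L hL ↦ exists_bound_on_compact_of_isCompact_weakSpace hW hL)
    (I.isCompact_biUnion fun φ _ ↦ hK φ)
  -- each of the functionals in `I` is pointwise continuous where functions are bounded by `m` on
  -- `A`
  refine ⟨A, hAN, m, hm, ?_⟩
  have hev : ∀ᶠ g : C(X, ℝ) in comap (⇑) (𝓝 (f : X → ℝ)) ⊓ 𝓟 {g | ∀ x ∈ A, |g x| ≤ m},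
      ∀ φ ∈ I, φ g ∈ u φ := by
    rw [Filter.eventually_all_finset]
    intro φ hφI
    have hKφ : K φ ⊆ A := (subset_biUnion_of_mem (u := fun φ ↦ K φ) hφI).trans hKA
    have ht := tendsto_apply_of_pointwise φ (hK φ) (hC φ) (hφ φ) (M := m) (f := f)
      fun x hx ↦ hm f hfW x (hKφ hx)
    refine (ht.mono_left ?_).eventually ((hu φ hφI).1.mem_nhds (hu φ hφI).2)
    exact inf_le_inf_left _ (principal_mono.2 fun g hg x hx ↦ hg x (hKφ hx))
  rw [eventually_inf_principal, eventually_comap] at hev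
  exact ⟨_, hev, fun g hgA hgV ↦ huO fun φ hφI ↦ hgV g rfl hgA φ hφI⟩

/-- The sets of functions which lie in a given `b ∈ B` and are bounded by a natural number on a
given member of `networkInters N`. -/
def weakNetwork (N : Set (Set X)) (B : Set (Set (X → ℝ))) : Set (Set (WeakSpace ℝ C(X, ℝ))) :=
  (fun p : (Set X × ℕ) × Set (X → ℝ) ↦
    {f | (∀ x ∈ p.1.1, |(toWeakSpace ℝ C(X, ℝ)).symm f x| ≤ p.1.2) ∧
      ((toWeakSpace ℝ C(X, ℝ)).symm f : X → ℝ) ∈ p.2}) '' ((networkInters N ×ˢ univ) ×ˢ B)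

lemma isKNetwork_weakNetwork [Countable X] [T3Space X] {N : Set (Set X)}
    (hN : IsKNetwork N) (hc : N.Countable) {B : Set (Set (X → ℝ))}
    (hB : TopologicalSpace.IsTopologicalBasis B) : IsKNetwork (weakNetwork N B) := by
  intro W U hW hU hWU
  -- the same bound holds on all of `W`, so `S` contains `W` near `f`, and not only `f`
  have key : ∀ f ∈ W, ∃ S ∈ weakNetwork N B, ∃ O, IsOpen O ∧ f ∈ O ∧ W ∩ O ⊆ S ∧ S ⊆ U := by
    intro f hf
    obtain ⟨A, hA, m, hm, V, hV, hVU⟩ := exists_pointwise_nhds_subset hN hc hW hU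
      (f := (toWeakSpace ℝ _).symm f) hf (hWU hf)
    obtain ⟨b, hb, hfb, hbV⟩ := hB.mem_nhds_iff.1 hV
    refine ⟨_, ⟨((A, m), b), ⟨⟨hA, mem_univ _⟩, hb⟩, rfl⟩, _,
      (hB.isOpen hb).preimage continuous_coe_weakSpace, hfb, ?_, ?_⟩
    · exact fun g hg ↦ ⟨hm _ hg.1, hg.2⟩
    · exact fun g hg ↦ hVU _ hg.1 (hbV hg.2)
  choose! S hS O hO hfO hOS hSU using key
  obtain ⟨t, htW, ht⟩ := hW.elim_nhds_subcover O fun f hf ↦ (hO f hf).mem_nhds (hfO f hf)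
  refine ⟨S '' t, ?_, t.finite_toSet.image S, fun f hf ↦ ?_, ?_⟩
  · rintro _ ⟨f, hf, rfl⟩
    exact hS f (htW f hf)
  · obtain ⟨g, hg, hfg⟩ := mem_iUnion₂.1 (ht hf)
    exact ⟨S g, ⟨g, hg, rfl⟩, hOS g (htW g hg) ⟨hf, hfg⟩⟩
  · rintro f ⟨_, ⟨g, hg, rfl⟩, hf⟩
    exact hSU g (htW g hg) hf

end Weak

/-- `C(X, ℝ)` carries the compact-open topology. -/
theorem mainTheorem7 (X : Type*) [TopologicalSpace X] [Countable X] (hX : IsAlephZeroSpace X) :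
    IsWeaklyAlephZeroSpace C(X, ℝ) := by
  obtain ⟨hT3, N, hNc, hN⟩ := hX
  refine ⟨inferInstance, weakNetwork N (TopologicalSpace.countableBasis (X → ℝ)), ?_,
    isKNetwork_weakNetwork hN hNc (TopologicalSpace.isBasis_countableBasis _)⟩
  exact (((countable_networkInters hNc).prod countable_univ).prod
    (TopologicalSpace.countable_countableBasis _)).image _
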